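/- Let $I=[a,b)$ be a bounded interval in $\mathbb{R}$ with $a<b$, and let $\mathcal{D}(I)$ be the family of its dyadic subintervals, that is, of all half-open intervals obtained from $I$ by repeated halving, $I$ included. For $J\in\mathcal{D}(I)$ write $|J|$ for its length and $\langle f\rangle_J=\frac1{|J|}\int_J f$. Let $t>0$, $\lambda>0$ and $0<A\le 1$. Then \[ \sup \frac{1}{|I|}\Bigl|\Bigl\{x\in I:\ \sum_{J\in\mathcal{D}(I)}\alpha_J\langle f\rangle_J\mathbf{1}_J(x)>\lambda\Bigr\}\Bigr|= \begin{cases} \dfrac{2At}{A\lambda+t} & \text{if } t\le A\lambda\le\lambda,\\[2mm] \sqrt{\dfrac{At}{\lambda}} & \text{if } A\le\min\bigl(\tfrac{t}{\lambda},\tfrac{\lambda}{t}\bigr),\\[2mm] 1 & \text{otherwise,} \end{cases} \] where the supremum is taken over all nonnegative integrable functions $f$ on $I$ with $\langle f\rangle_I=t$ and all nonnegative sequences $(\alpha_J)_{J\in\mathcal{D}(I)}$ with Carleson constant at most $1$, that is, \[ \sup_{J\in\mathcal{D}(I)}\frac{1}{|J|}\sum_{K\in\mathcal{D}(J)}\alpha_K|K|\le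 1, \qquad\text{and with}\qquad \frac{1}{|I|}\sum_{J\in\mathcal{D}(I)}\alpha_J|J|=A . \] (In the overlap $t=A\lambda$ of the first two cases the two formulas agree.) -/

import Mathlib

open MeasureTheory
open scoped ENNReal

noncomputable section

namespace LernerOperator

/-- Endpoints of the dyadic subinterval of `[a, b)` with address `w`: starting from `[a, b)`, read
`w` from left to right, passing to the left half at `false` and to the right half at `true`.
Every dyadic subinterval has exactly one address when `a < b`; the empty address is `[a, b)`. -/
def endpoints : ℝ → ℝ → List Bool → ℝ × ℝ
  | a, b, [] => (a, b)
  | a, b, false :: w => endpoints a ((a + b) / 2) w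
  | a, b, true :: w => endpoints ((a + b) / 2) b w

/-- The dyadic subinterval of `[a, b)` with address `J`. The dyadic subintervals of this interval,
itself included, are those with address `J ++ K`, for `K` an arbitrary address. -/
def dyadicInterval (a b : ℝ) (J : List Bool) : Set ℝ :=
  Set.Ico (endpoints a b J).1 (endpoints a b J).2

/-- `(1 / |J|) ∑ α_K |K|`, the sum over all dyadic subintervals `K` of `J`. -/
def normalizedMass (a b : ℝ) (α : List Bool → ℝ) (J : List Bool) : ℝ≥0∞ :=
  (∑' K : List Bool, ENNReal.ofReal (α (J ++ K)) * volume (dyadicInterval a b (J ++ K))) /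
    volume (dyadicInterval a b J)

/-- The Carleson constant of a nonnegative sequence `α` indexed by the dyadic subintervals
of `[a, b)`. -/
def carlesonConstant (a b : ℝ) (α : List Bool → ℝ) : ℝ≥0∞ :=
  ⨆ J : List Bool, normalizedMass a b α J

/-- `∑ α_J ⟨f⟩_J 1_J(x)`, the sum over all dyadic subintervals `J` of `[a, b)`; for nonnegative
`α` and `f` it is a series of nonnegative terms with value in `[0, ∞]`. -/
def lernerOp (a b : ℝ) (α : List Bool → ℝ) (f : ℝ → ℝ) (x : ℝ) : ℝ≥0∞ :=
  ∑' J : List Bool, (dyadicInterval a b J).indicator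
    (fun _ => ENNReal.ofReal (α J * ⨍ y in dyadicInterval a b J, f y)) x

/-- The pairs `(f, α)` over which the supremum is taken: `f` is nonnegative and integrable on
`[a, b)` with average `t`, and `α` is nonnegative with Carleson constant at most `1` and
normalized total mass `A`. -/
def Admissible (a b t A : ℝ) (f : ℝ → ℝ) (α : List Bool → ℝ) : Prop :=
  (∀ x ∈ Set.Ico a b, 0 ≤ f x) ∧ IntegrableOn f (Set.Ico a b) ∧ (⨍ x in Set.Ico a b, f x) = t ∧
    (∀ J, 0 ≤ α J) ∧ carlesonConstant a b α ≤ 1 ∧ normalizedMass a b α [] = ENNReal.ofReal A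

end LernerOperator

end

/-!
The proof is by the Bellman function method. As a function of the average `t` of `f`, the mass `A`
of `α` and the level `lam`, the largest density of the level set obeys two rules. Gluing data on
the two halves of an interval, with coefficient zero at the top, shows that it is midpoint concave
in `(t, A)`. Raising the top coefficient by `c` adds `c * t` to the operator on the whole interval,
so it does not decrease along `(t, A, lam) ↦ (t, A + c, lam + c * t)`.

Any nonnegative `B` obeying both rules, and at least `1` where the top coefficient alone can reach
the level, is an upper bound, by induction on the number of generations on which `α` lives. With
`x = t / lam`, the claimed value is the minimum of `1` and the mean of `x` and `A` that is harmonic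
for `x ≤ A` and geometric for `x ≥ A`. It is midpoint concave because this mean is homogeneous and
superadditive.

Conversely the two rules generate extremizers. By midpoint concavity with the zero data, densities
scale linearly along `(θ * t, θ * A)`. For full mass `A = 1`, concentrating `f` on a proportion `q`
of the interval and spending the freed mass `1 - q` at the top replaces `(t, lam)` by
`(t / q, lam - (1 - q) * t)` at the cost of a factor `q`. Iterating with `q → 1` yields the
harmonic mean; the geometric mean arises from a single concentration.
-/

namespace LernerOperator

theorem sqrt_mul_add_sqrt_mul_le {x y A B : ℝ} (hx : 0 ≤ x) (hy : 0 ≤ y) (hA : 0 ≤ A)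
    (hB : 0 ≤ B) : √(A * x) + √(B * y) ≤ √((A + B) * (x + y)) := by
  have h := Real.sum_sqrt_mul_sqrt_le (f := ![A, B]) (g := ![x, y]) Finset.univ
    (Fin.forall_fin_two.2 ⟨hA, hB⟩) (Fin.forall_fin_two.2 ⟨hx, hy⟩)
  simpa [Fin.sum_univ_two, Real.sqrt_mul, hA, hB, add_nonneg] using h

theorem add_sq_div_add_le {x y a b : ℝ} (ha : 0 < a) (hb : 0 < b) :
    (x + y) ^ 2 / (a + b) ≤ x ^ 2 / a + y ^ 2 / b := by
  simpa [Fin.sum_univ_two] using Finset.sq_sum_div_le_sum_sq_div Finset.univ ![x, y]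
    (g := ![a, b]) (by simp [ha, hb])

/-- The harmonic mean of `x` and `A` below the diagonal `x = A`, the geometric mean above it. -/
noncomputable def mixedMean (x A : ℝ) : ℝ :=
  if x ≤ A then 2 * A * x / (A + x) else √(A * x)

theorem mixedMean_zero (x : ℝ) : mixedMean x 0 = 0 := by
  simp [mixedMean]

theorem mixedMean_nonneg {x A : ℝ} (hx : 0 ≤ x) (hA : 0 ≤ A) : 0 ≤ mixedMean x A := by
  unfold mixedMean
  split_ifs <;> positivity

theorem mixedMean_of_ge {x A : ℝ} (hA : 0 ≤ A) (h : A ≤ x) : mixedMean x A = √(A * x) := by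
  rcases h.eq_or_lt with rfl | h'
  · rw [mixedMean, if_pos le_rfl, Real.sqrt_mul_self hA]
    grind
  · rw [mixedMean, if_neg h'.not_ge]

theorem mixedMean_of_le {x A : ℝ} (hx : 0 ≤ x) (h : x ≤ A) :
    mixedMean x A = (A + x) / 2 - (A - x) ^ 2 / (A + x) / 2 := by
  rw [mixedMean, if_pos h]
  rcases (add_nonneg (hx.trans h) hx).eq_or_lt with h0 | h0
  · simp [← h0]
  · field_simp
    ring

theorem mixedMean_div_of_le {t A lam : ℝ} (hlam : 0 < lam) (h : t ≤ A * lam) :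
    mixedMean (t / lam) A = 2 * A * t / (A * lam + t) := by
  rw [mixedMean, if_pos ((div_le_iff₀ hlam).2 h)]
  field_simp

theorem mixedMean_div_of_ge {t A lam : ℝ} (hA : 0 ≤ A) (hlam : 0 < lam) (h : A * lam ≤ t) :
    mixedMean (t / lam) A = √(A * t / lam) := by
  rw [mixedMean_of_ge hA ((le_div_iff₀ hlam).2 h), mul_div_assoc]

theorem mixedMean_le_sqrt {x A : ℝ} (hx : 0 ≤ x) (hA : 0 ≤ A) : mixedMean x A ≤ √(A * x) := by
  rcases le_total x A with h | h
  · rw [mixedMean, if_pos h]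
    apply Real.le_sqrt_of_sq_le
    rw [div_pow]
    refine div_le_of_le_mul₀ (by positivity) (by positivity) ?_
    linarith [mul_nonneg (mul_nonneg hA hx) (sq_nonneg (A - x))]
  · exact (mixedMean_of_ge hA h).le

theorem mixedMean_le_sub {x A : ℝ} (hx : 0 ≤ x) (hA : 0 ≤ A) :
    mixedMean x A ≤ (A + x) / 2 - max (A - x) 0 ^ 2 / (A + x) / 2 := by
  rcases le_total x A with h | h
  · rw [mixedMean_of_le hx h, max_eq_left (sub_nonneg.2 h)]
  · have amgm : √(A * x) ≤ (A + x) / 2 :=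
      Real.sqrt_le_iff.2 ⟨by positivity, by linarith [sq_nonneg (A - x)]⟩
    simpa [mixedMean_of_ge hA h, max_eq_right (sub_nonpos.2 h)] using amgm

theorem mixedMean_smul {r : ℝ} (hr : 0 < r) (x A : ℝ) :
    mixedMean (r * x) (r * A) = r * mixedMean x A := by
  unfold mixedMean
  simp only [mul_le_mul_iff_right₀ hr, mul_ite]
  congr 1
  · rw [← mul_add]
    field_simp
  · rw [mul_mul_mul_comm, Real.sqrt_mul (mul_self_nonneg r), Real.sqrt_mul_self hr.le]

theorem add_mixedMean_le {x y A B : ℝ} (hx : 0 ≤ x) (hy : 0 ≤ y) (hA : 0 ≤ A) (hB : 0 ≤ B) :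
    mixedMean x A + mixedMean y B ≤ mixedMean (x + y) (A + B) := by
  rcases le_total (A + B) (x + y) with h | h
  · rw [mixedMean_of_ge (add_nonneg hA hB) h]
    exact (add_le_add (mixedMean_le_sqrt hx hA) (mixedMean_le_sqrt hy hB)).trans
      (sqrt_mul_add_sqrt_mul_le hx hy hA hB)
  rcases (add_nonneg hA hx).eq_or_lt with h₁ | h₁
  · obtain ⟨rfl, rfl⟩ : A = 0 ∧ x = 0 := (add_eq_zero_iff_of_nonneg hA hx).1 h₁.symm
    simp [mixedMean_zero]
  rcases (add_nonneg hB hy).eq_or_lt with h₂ | h₂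
  · obtain ⟨rfl, rfl⟩ : B = 0 ∧ y = 0 := (add_eq_zero_iff_of_nonneg hB hy).1 h₂.symm
    simp [mixedMean_zero]
  -- Below the diagonal the harmonic mean is the arithmetic mean minus a subadditive defect.
  have defect : (A + B - (x + y)) ^ 2 / (A + B + (x + y)) ≤
      max (A - x) 0 ^ 2 / (A + x) + max (B - y) 0 ^ 2 / (B + y) := calc
    _ ≤ (max (A - x) 0 + max (B - y) 0) ^ 2 / ((A + x) + (B + y)) := by
      rw [add_add_add_comm A B]
      gcongr ?_ ^ 2 / _
      linarith [le_max_left (A - x) 0, le_max_left (B - y) 0]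
    _ ≤ _ := add_sq_div_add_le h₁ h₂
  rw [mixedMean_of_le (add_nonneg hx hy) h]
  linarith [mixedMean_le_sub hx hA, mixedMean_le_sub hy hB]

section Jump

variable {t A lam c : ℝ}

theorem mixedMean_jump_of_ge (ht : 0 ≤ t) (hA : 0 ≤ A) (hc : 0 ≤ c) (hlam : 0 < lam)
    (hAt : A * t ≤ lam) (h : (A + c) * (lam + c * t) ≤ t) :
    mixedMean (t / lam) A ≤ mixedMean (t / (lam + c * t)) (A + c) := by
  have hlam' : 0 < lam + c * t := by positivity
  rw [mixedMean_div_of_ge (by positivity) hlam' h]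
  refine (mixedMean_le_sqrt (by positivity) hA).trans (Real.sqrt_le_sqrt ?_)
  rw [← mul_div_assoc, div_le_div_iff₀ hlam hlam']
  linarith [mul_le_mul_of_nonneg_left hAt (mul_nonneg hc ht)]

theorem mixedMean_jump_of_le (ht : 0 < t) (hA : 0 ≤ A) (hc : 0 ≤ c) (hAc : A + c ≤ 1)
    (hlam : 0 < lam) (h : t ≤ A * lam) :
    mixedMean (t / lam) A ≤ mixedMean (t / (lam + c * t)) (A + c) := by
  have h' : t ≤ (A + c) * (lam + c * t) :=
    h.trans (mul_le_mul (by linarith) (by nlinarith) hlam.le (by positivity))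
  have hAA : A * (A + c) ≤ 1 := mul_le_one₀ (by linarith) (by positivity) hAc
  rw [mixedMean_div_of_le hlam h, mixedMean_div_of_le (by positivity) h',
    div_le_div_iff₀ (by positivity) (by positivity)]
  linarith [mul_le_mul_of_nonneg_left hAA (show 0 ≤ 2 * c * t ^ 2 by positivity)]

theorem mixedMean_jump (ht : 0 ≤ t) (hA : 0 ≤ A) (hc : 0 ≤ c) (hAc : A + c ≤ 1) (hlam : 0 < lam)
    (hAt : A * t ≤ lam) : mixedMean (t / lam) A ≤ mixedMean (t / (lam + c * t)) (A + c) := by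
  rcases ht.eq_or_lt with rfl | ht
  · simp [mixedMean, hA, add_nonneg hA hc]
  rcases le_total t (A * lam) with h | h
  · exact mixedMean_jump_of_le ht hA hc hAc hlam h
  rcases le_total ((A + c) * (lam + c * t)) t with h' | h'
  · exact mixedMean_jump_of_ge ht.le hA hc hlam hAt h'
  -- The jump crosses the diagonal of `mixedMean`: split it there.
  obtain ⟨d, ⟨hd, hdc⟩, hdt⟩ : ∃ d ∈ Set.Icc 0 c, (A + d) * (lam + d * t) = t :=
    intermediate_value_Icc hc (by fun_prop) ⟨by simpa using h, h'⟩
  have hlam' : 0 < lam + d * t := by positivity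
  calc mixedMean (t / lam) A ≤ mixedMean (t / (lam + d * t)) (A + d) :=
        mixedMean_jump_of_ge ht.le hA hd hlam hAt hdt.le
    _ ≤ mixedMean (t / (lam + d * t + (c - d) * t)) (A + d + (c - d)) :=
        mixedMean_jump_of_le ht (by positivity) (sub_nonneg.2 hdc) (by linarith) hlam' hdt.ge
    _ = mixedMean (t / (lam + c * t)) (A + c) := by ring_nf

end Jump

/-- The Bellman function of the weak-type problem: the supremum of the level densities over the
admissible pairs with average `t` and mass `A`, at the level `lam`. -/
noncomputable def bellman (t A lam : ℝ) : ℝ := min 1 (mixedMean (t / lam) A)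

theorem bellman_of_le {t A lam : ℝ} (hA : 0 ≤ A) (hA1 : A ≤ 1) (hlam : 0 < lam)
    (h : lam ≤ A * t) : bellman t A lam = 1 := by
  have ht : 0 < t := pos_of_mul_pos_right (hlam.trans_le h) hA
  have hAt : A * lam ≤ t := calc
    A * lam ≤ lam := mul_le_of_le_one_left hlam.le hA1
    _ ≤ A * t := h
    _ ≤ t := mul_le_of_le_one_left ht.le hA1
  rw [bellman, mixedMean_div_of_ge hA hlam hAt, min_eq_left]
  exact Real.one_le_sqrt.2 ((one_le_div hlam).2 h)

theorem bellman_eq {t A lam : ℝ} (ht : 0 < t) (hA : 0 < A) (hA1 : A ≤ 1) (hlam : 0 < lam) :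
    bellman t A lam = if t ≤ A * lam ∧ A * lam ≤ lam then 2 * A * t / (A * lam + t)
      else if A ≤ min (t / lam) (lam / t) then √(A * t / lam) else 1 := by
  have hAlam : A * lam ≤ lam := mul_le_of_le_one_left hlam.le hA1
  simp only [hAlam, and_true, le_min_iff, le_div_iff₀ hlam, le_div_iff₀ ht]
  split_ifs with h₁ h₂
  · rw [bellman, mixedMean_div_of_le hlam h₁, min_eq_right]
    rw [div_le_one (by positivity)]
    nlinarith
  · rw [bellman, mixedMean_div_of_ge hA.le hlam h₂.1, min_eq_right]
    exact Real.sqrt_le_one.2 ((div_le_one hlam).2 h₂.2)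
  · refine bellman_of_le hA.le hA1 hlam ?_
    by_contra! h
    exact h₂ ⟨(not_le.1 h₁).le, h.le⟩

/-- The conditions on a function of the average `t`, the mass `A` and the level `lam` which make
it, by induction on the dyadic generation, an upper bound for the level densities. -/
structure IsSupersolution (B : ℝ → ℝ → ℝ → ℝ) : Prop where
  nonneg : ∀ {t A lam : ℝ}, 0 ≤ t → 0 ≤ A → 0 < lam → 0 ≤ B t A lam
  one_le : ∀ {t A lam : ℝ}, 0 ≤ A → A ≤ 1 → 0 < lam → lam ≤ A * t → 1 ≤ B t A lam
  midpoint_le : ∀ {t₁ t₂ A₁ A₂ lam : ℝ}, 0 ≤ t₁ → 0 ≤ t₂ → 0 ≤ A₁ → 0 ≤ A₂ → 0 < lam →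
    (B t₁ A₁ lam + B t₂ A₂ lam) / 2 ≤ B ((t₁ + t₂) / 2) ((A₁ + A₂) / 2) lam
  jump_le : ∀ {t A c lam : ℝ}, 0 ≤ t → 0 ≤ A → 0 ≤ c → A + c ≤ 1 → 0 < lam →
    B t A lam ≤ B t (A + c) (lam + c * t)

theorem bellman_midpoint_le {t₁ t₂ A₁ A₂ lam : ℝ} (ht₁ : 0 ≤ t₁) (ht₂ : 0 ≤ t₂) (hA₁ : 0 ≤ A₁)
    (hA₂ : 0 ≤ A₂) (hlam : 0 < lam) :
    (bellman t₁ A₁ lam + bellman t₂ A₂ lam) / 2 ≤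
      bellman ((t₁ + t₂) / 2) ((A₁ + A₂) / 2) lam := by
  refine le_min ?_ ?_
  · have h₁ : bellman t₁ A₁ lam ≤ 1 := min_le_left _ _
    have h₂ : bellman t₂ A₂ lam ≤ 1 := min_le_left _ _
    linarith
  · calc (bellman t₁ A₁ lam + bellman t₂ A₂ lam) / 2
        ≤ 2⁻¹ * (mixedMean (t₁ / lam) A₁ + mixedMean (t₂ / lam) A₂) := by
          rw [div_eq_inv_mul]
          gcongr <;> exact min_le_right _ _
      _ ≤ 2⁻¹ * mixedMean (t₁ / lam + t₂ / lam) (A₁ + A₂) := by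
          gcongr
          exact add_mixedMean_le (by positivity) (by positivity) hA₁ hA₂
      _ = mixedMean ((t₁ + t₂) / 2 / lam) ((A₁ + A₂) / 2) := by
          rw [← mixedMean_smul (by positivity)]
          ring_nf

theorem bellman_jump_le {t A c lam : ℝ} (ht : 0 ≤ t) (hA : 0 ≤ A) (hc : 0 ≤ c) (hAc : A + c ≤ 1)
    (hlam : 0 < lam) : bellman t A lam ≤ bellman t (A + c) (lam + c * t) := by
  rcases le_total (A * t) lam with h | h
  · exact min_le_min_left 1 (mixedMean_jump ht hA hc hAc hlam h)
  · rw [bellman_of_le (by positivity) hAc (by positivity) (by linarith)]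
    exact min_le_left _ _

theorem isSupersolution_bellman : IsSupersolution bellman where
  nonneg ht hA hlam := le_min zero_le_one (mixedMean_nonneg (div_nonneg ht hlam.le) hA)
  one_le hA hA1 hlam h := (bellman_of_le hA hA1 hlam h).ge
  midpoint_le := bellman_midpoint_le
  jump_le := bellman_jump_le

theorem tsum_list {ι : Type*} (F : List ι → ℝ≥0∞) :
    ∑' J, F J = F [] + ∑' i, ∑' J, F (i :: J) := by
  let e : Unit ⊕ ι × List ι ≃ List ι :=
    { toFun := Sum.elim (fun _ => []) fun p => p.1 :: p.2
      invFun := fun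
        | [] => .inl ()
        | i :: J => .inr (i, J)
      left_inv := by rintro (_ | _) <;> rfl
      right_inv := by rintro (_ | _) <;> rfl }
  rw [← e.tsum_eq, ENNReal.summable.tsum_sum ENNReal.summable,
    ← ENNReal.tsum_prod (f := fun i J => F (i :: J))]
  simp [e]

theorem average_Ico_nonneg {a b : ℝ} {f : ℝ → ℝ} (hf : ∀ x ∈ Set.Ico a b, 0 ≤ f x) :
    0 ≤ ⨍ x in Set.Ico a b, f x := by
  rw [setAverage_eq]
  exact smul_nonneg (by positivity) (setIntegral_nonneg measurableSet_Ico hf)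

theorem average_Ico_eq_add_div_two {a b : ℝ} (hab : a < b) {f : ℝ → ℝ}
    (hf : IntegrableOn f (Set.Ico a b)) :
    ⨍ x in Set.Ico a b, f x =
      ((⨍ x in Set.Ico a ((a + b) / 2), f x) + ⨍ x in Set.Ico ((a + b) / 2) b, f x) / 2 := by
  have hl := (left_lt_add_div_two.2 hab).le
  have hr := (add_div_two_lt_right.2 hab).le
  rw [← Set.Ico_union_Ico_eq_Ico hl hr] at hf
  have hsum := setIntegral_union Set.Ico_disjoint_Ico_same measurableSet_Ico
    hf.left_of_union hf.right_of_union
  rw [Set.Ico_union_Ico_eq_Ico hl hr] at hsum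
  simp only [setAverage_eq, Real.volume_real_Ico_of_le hab.le, Real.volume_real_Ico_of_le hl,
    Real.volume_real_Ico_of_le hr, hsum, smul_eq_mul]
  rw [show (a + b) / 2 - a = (b - a) / 2 by ring, show b - (a + b) / 2 = (b - a) / 2 by ring,
    inv_div]
  ring

theorem dyadicInterval_subset {a b : ℝ} (hab : a < b) (J : List Bool) :
    dyadicInterval a b J ⊆ Set.Ico a b := by
  induction J generalizing a b with
  | nil => exact subset_rfl
  | cons c J ih =>
    have hl := left_lt_add_div_two.2 hab
    have hr := add_div_two_lt_right.2 hab
    cases c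
    · exact (ih hl).trans (Set.Ico_subset_Ico_right hr.le)
    · exact (ih hr).trans (Set.Ico_subset_Ico_left hl.le)

/-- The sequence with coefficient `s` at the top interval and with restrictions `α` and `β` to its
left and right halves. Every sequence is of this form, see `exists_eq_glueSeq`. -/
def glueSeq (s : ℝ) (α β : List Bool → ℝ) : List Bool → ℝ
  | [] => s
  | false :: J => α J
  | true :: J => β J

theorem exists_eq_glueSeq (γ : List Bool → ℝ) : ∃ s α β, γ = glueSeq s α β :=
  ⟨γ [], γ ∘ List.cons false, γ ∘ List.cons true, by ext (_ | ⟨_ | _, J⟩) <;> rfl⟩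

section LevelSet

variable {a b : ℝ} {α β : List Bool → ℝ} {f g : ℝ → ℝ} {x s lam : ℝ}

theorem lernerOp_of_notMem (hab : a < b) (hx : x ∉ Set.Ico a b) : lernerOp a b α f x = 0 :=
  ENNReal.tsum_eq_zero.2 fun J => Set.indicator_of_notMem (mt (dyadicInterval_subset hab J ·) hx) _

theorem measurable_lernerOp : Measurable (lernerOp a b α f) :=
  Measurable.tsum fun _ => measurable_const.indicator measurableSet_Ico

theorem lernerOp_congr (hab : a < b) (h : Set.EqOn f g (Set.Ico a b)) :
    lernerOp a b α f = lernerOp a b α g := by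
  ext x
  refine tsum_congr fun J => ?_
  rw [setAverage_congr_fun (s := dyadicInterval a b J) measurableSet_Ico
    (ae_of_all _ fun y hy => h (dyadicInterval_subset hab J hy))]

theorem lernerOp_glueSeq (hx : x ∈ Set.Ico a b) :
    lernerOp a b (glueSeq s α β) f x = ENNReal.ofReal (s * ⨍ y in Set.Ico a b, f y) +
      (lernerOp a ((a + b) / 2) α f x + lernerOp ((a + b) / 2) b β f x) := by
  rw [lernerOp, tsum_list, tsum_bool]
  congr 1
  exact Set.indicator_of_mem hx _

/-- The part of `[a, b)` on which the operator exceeds the level `lam`. -/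
def levelSet (a b : ℝ) (α : List Bool → ℝ) (f : ℝ → ℝ) (lam : ℝ) : Set ℝ :=
  {x | x ∈ Set.Ico a b ∧ ENNReal.ofReal lam < lernerOp a b α f x}

/-- The proportion of `[a, b)` filled by the level set, the quantity to be maximized. -/
noncomputable def levelDensity (a b : ℝ) (α : List Bool → ℝ) (f : ℝ → ℝ) (lam : ℝ) : ℝ :=
  volume.real (levelSet a b α f lam) / (b - a)

theorem levelSet_subset : levelSet a b α f lam ⊆ Set.Ico a b := fun _ hx => hx.1

theorem measurableSet_levelSet : MeasurableSet (levelSet a b α f lam) :=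
  measurableSet_Ico.inter (measurableSet_lt measurable_const measurable_lernerOp)

theorem volume_levelSet_ne_top : volume (levelSet a b α f lam) ≠ ∞ :=
  measure_ne_top_of_subset levelSet_subset measure_Ico_lt_top.ne

theorem levelDensity_nonneg (hab : a ≤ b) : 0 ≤ levelDensity a b α f lam :=
  div_nonneg measureReal_nonneg (sub_nonneg.2 hab)

theorem levelDensity_le_one (hab : a ≤ b) : levelDensity a b α f lam ≤ 1 := by
  refine div_le_one_of_le₀ ?_ (sub_nonneg.2 hab)
  rw [← Real.volume_real_Ico_of_le hab]
  exact measureReal_mono levelSet_subset measure_Ico_lt_top.ne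

theorem levelDensity_congr (hab : a < b) (h : Set.EqOn f g (Set.Ico a b)) :
    levelDensity a b α f lam = levelDensity a b α g lam := by
  simp only [levelDensity, levelSet, lernerOp_congr hab h]

theorem levelSet_glueSeq_zero (hab : a < b) :
    levelSet a b (glueSeq 0 α β) f lam =
      levelSet a ((a + b) / 2) α f lam ∪ levelSet ((a + b) / 2) b β f lam := by
  have hl := left_lt_add_div_two.2 hab
  have hr := add_div_two_lt_right.2 hab
  ext x
  by_cases hx : x ∈ Set.Ico a b
  · rcases lt_or_ge x ((a + b) / 2) with hm | hm
    · have hx' : x ∉ Set.Ico ((a + b) / 2) b := fun h => h.1.not_gt hm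
      simp [levelSet, lernerOp_glueSeq hx, lernerOp_of_notMem hr hx', hx.1, hx.2, hm, hm.not_ge]
    · have hx' : x ∉ Set.Ico a ((a + b) / 2) := fun h => h.2.not_ge hm
      simp [levelSet, lernerOp_glueSeq hx, lernerOp_of_notMem hl hx', hx.1, hx.2, hm, hm.not_gt]
  · have hl' : x ∉ Set.Ico a ((a + b) / 2) := fun h => hx (Set.Ico_subset_Ico_right hr.le h)
    have hr' : x ∉ Set.Ico ((a + b) / 2) b := fun h => hx (Set.Ico_subset_Ico_left hl.le h)
    simp only [levelSet, Set.mem_union, Set.mem_ofPred_eq, hx, hl', hr', false_and, or_self]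

theorem levelDensity_glueSeq_zero (hab : a < b) :
    levelDensity a b (glueSeq 0 α β) f lam =
      (levelDensity a ((a + b) / 2) α f lam + levelDensity ((a + b) / 2) b β f lam) / 2 := by
  have hdisj : Disjoint (levelSet a ((a + b) / 2) α f lam) (levelSet ((a + b) / 2) b β f lam) :=
    Set.Ico_disjoint_Ico_same.mono levelSet_subset levelSet_subset
  rw [levelDensity, levelSet_glueSeq_zero hab, measureReal_union hdisj measurableSet_levelSet
    volume_levelSet_ne_top volume_levelSet_ne_top, levelDensity, levelDensity,
    show (a + b) / 2 - a = (b - a) / 2 by ring, show b - (a + b) / 2 = (b - a) / 2 by ring]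
  field_simp

theorem levelDensity_glueSeq_add {s₀ : ℝ} (hs₀ : 0 ≤ s₀) (hs : 0 ≤ s)
    (hf : 0 ≤ ⨍ y in Set.Ico a b, f y) (hlam : 0 ≤ lam) :
    levelDensity a b (glueSeq (s₀ + s) α β) f (lam + s * ⨍ y in Set.Ico a b, f y) =
      levelDensity a b (glueSeq s₀ α β) f lam := by
  unfold levelDensity levelSet
  congr 3 with x
  refine and_congr_right fun hx => ?_
  rw [lernerOp_glueSeq hx, lernerOp_glueSeq hx, add_mul, ENNReal.ofReal_add hlam (by positivity),
    ENNReal.ofReal_add (mul_nonneg hs₀ hf) (mul_nonneg hs hf), add_right_comm,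
    ENNReal.add_lt_add_iff_right ENNReal.ofReal_ne_top]

theorem levelDensity_glueSeq (hab : a < b) (hs : 0 ≤ s) (hf : 0 ≤ ⨍ y in Set.Ico a b, f y)
    (hlam : 0 ≤ lam) :
    levelDensity a b (glueSeq s α β) f (lam + s * ⨍ y in Set.Ico a b, f y) =
      (levelDensity a ((a + b) / 2) α f lam + levelDensity ((a + b) / 2) b β f lam) / 2 := by
  rw [← levelDensity_glueSeq_zero hab, ← levelDensity_glueSeq_add le_rfl hs hf hlam, zero_add]

end LevelSet

section Mass

variable {a b s : ℝ} {α β : List Bool → ℝ}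

theorem normalizedMass_glueSeq_nil (hab : a < b) :
    normalizedMass a b (glueSeq s α β) [] = ENNReal.ofReal s +
      (normalizedMass a ((a + b) / 2) α [] + normalizedMass ((a + b) / 2) b β []) / 2 := by
  have hvol : volume (Set.Ico a b) ≠ 0 := by simpa using hab
  have div_half {S : ℝ≥0∞} {c d : ℝ} (hcd : (d - c) * 2 = b - a) :
      S / volume (Set.Ico a b) = S / volume (Set.Ico c d) / 2 := by
    rw [Real.volume_Ico, Real.volume_Ico, ← hcd, ENNReal.ofReal_mul' zero_le_two,
      ENNReal.ofReal_ofNat, div_eq_mul_inv, div_eq_mul_inv, div_eq_mul_inv, mul_assoc,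
      ENNReal.mul_inv (.inr ENNReal.ofNat_ne_top) (.inr two_ne_zero)]
  rw [normalizedMass, tsum_list, tsum_bool, ENNReal.add_div, ENNReal.add_div, ENNReal.add_div]
  congr 1
  · exact ENNReal.mul_div_cancel_right hvol measure_Ico_lt_top.ne
  · congr 1
    · exact div_half (show ((a + b) / 2 - a) * 2 = b - a by ring)
    · exact div_half (show (b - (a + b) / 2) * 2 = b - a by ring)

theorem normalizedMass_glueSeq_nil_eq_ofReal {A₁ A₂ : ℝ} (hab : a < b) (hs : 0 ≤ s) (hA₁ : 0 ≤ A₁)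
    (hA₂ : 0 ≤ A₂) (hα : normalizedMass a ((a + b) / 2) α [] = ENNReal.ofReal A₁)
    (hβ : normalizedMass ((a + b) / 2) b β [] = ENNReal.ofReal A₂) :
    normalizedMass a b (glueSeq s α β) [] = ENNReal.ofReal (s + (A₁ + A₂) / 2) := by
  rw [normalizedMass_glueSeq_nil hab, hα, hβ, ← ENNReal.ofReal_add hA₁ hA₂,
    ENNReal.ofReal_add hs (by positivity), ENNReal.ofReal_div_of_pos two_pos, ENNReal.ofReal_ofNat]

theorem carlesonConstant_glueSeq_le_one_iff :
    carlesonConstant a b (glueSeq s α β) ≤ 1 ↔ normalizedMass a b (glueSeq s α β) [] ≤ 1 ∧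
      carlesonConstant a ((a + b) / 2) α ≤ 1 ∧ carlesonConstant ((a + b) / 2) b β ≤ 1 := by
  simp only [carlesonConstant, iSup_le_iff]
  refine ⟨fun h => ⟨h [], fun J => h (false :: J), fun J => h (true :: J)⟩, ?_⟩
  rintro ⟨hnil, hl, hr⟩ (_ | ⟨_ | _, J⟩)
  exacts [hnil, hl J, hr J]

end Mass

section Admissible

variable {a b t A s : ℝ} {f g : ℝ → ℝ} {α β : List Bool → ℝ}

theorem Admissible.average_nonneg (h : Admissible a b t A f α) : 0 ≤ t :=
  h.2.2.1 ▸ average_Ico_nonneg h.1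

theorem Admissible.mass_le_one (h : Admissible a b t A f α) : A ≤ 1 := by
  obtain ⟨-, -, -, -, hC, hA⟩ := h
  exact ENNReal.ofReal_le_one.1 (hA ▸ (le_iSup _ []).trans hC)

theorem Admissible.congr (hfg : Set.EqOn f g (Set.Ico a b)) (h : Admissible a b t A f α) :
    Admissible a b t A g α := by
  obtain ⟨hf, hfi, hft, hα⟩ := h
  refine ⟨fun x hx => hfg hx ▸ hf x hx, hfi.congr_fun hfg measurableSet_Ico, ?_, hα⟩
  rw [← hft, setAverage_congr_fun measurableSet_Ico (ae_of_all _ fun _ hy => (hfg hy).symm)]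

theorem Admissible.exists_halves (hab : a < b) (hA : 0 ≤ A)
    (h : Admissible a b t A f (glueSeq s α β)) :
    0 ≤ s ∧ ∃ t₁ A₁ t₂ A₂, 0 ≤ A₁ ∧ 0 ≤ A₂ ∧ Admissible a ((a + b) / 2) t₁ A₁ f α ∧
      Admissible ((a + b) / 2) b t₂ A₂ f β ∧ t = (t₁ + t₂) / 2 ∧ A = s + (A₁ + A₂) / 2 := by
  obtain ⟨hf, hfi, hft, hγ, hC, hm⟩ := h
  obtain ⟨-, hCα, hCβ⟩ := carlesonConstant_glueSeq_le_one_iff.1 hC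
  have hl : Set.Ico a ((a + b) / 2) ⊆ Set.Ico a b :=
    Set.Ico_subset_Ico_right (add_div_two_lt_right.2 hab).le
  have hr : Set.Ico ((a + b) / 2) b ⊆ Set.Ico a b :=
    Set.Ico_subset_Ico_left (left_lt_add_div_two.2 hab).le
  have ofReal_mass {c d : ℝ} {γ : List Bool → ℝ} (hγ : carlesonConstant c d γ ≤ 1) :
      normalizedMass c d γ [] = ENNReal.ofReal (normalizedMass c d γ []).toReal :=
    (ENNReal.ofReal_toReal (((le_iSup _ []).trans hγ).trans_lt ENNReal.one_lt_top).ne).symm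
  refine ⟨hγ [], _, _, _, _, ENNReal.toReal_nonneg, ENNReal.toReal_nonneg,
    ⟨fun x hx => hf x (hl hx), hfi.mono_set hl, rfl, fun J => hγ (false :: J), hCα,
      ofReal_mass hCα⟩,
    ⟨fun x hx => hf x (hr hx), hfi.mono_set hr, rfl, fun J => hγ (true :: J), hCβ,
      ofReal_mass hCβ⟩, hft ▸ average_Ico_eq_add_div_two hab hfi, ?_⟩
  have hs : 0 ≤ s := hγ []
  rw [normalizedMass_glueSeq_nil_eq_ofReal hab hs ENNReal.toReal_nonneg ENNReal.toReal_nonneg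
    (ofReal_mass hCα) (ofReal_mass hCβ), ENNReal.ofReal_eq_ofReal_iff (by positivity) hA] at hm
  exact hm.symm

theorem Admissible.glue {t₁ t₂ A₁ A₂ : ℝ} (hab : a < b) (hs : 0 ≤ s) (hA₁ : 0 ≤ A₁) (hA₂ : 0 ≤ A₂)
    (hA : s + (A₁ + A₂) / 2 ≤ 1) (h₁ : Admissible a ((a + b) / 2) t₁ A₁ f α)
    (h₂ : Admissible ((a + b) / 2) b t₂ A₂ f β) :
    Admissible a b ((t₁ + t₂) / 2) (s + (A₁ + A₂) / 2) f (glueSeq s α β) := by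
  obtain ⟨hf₁, hfi₁, hft₁, hα, hCα, hmα⟩ := h₁
  obtain ⟨hf₂, hfi₂, hft₂, hβ, hCβ, hmβ⟩ := h₂
  have hunion : Set.Ico a ((a + b) / 2) ∪ Set.Ico ((a + b) / 2) b = Set.Ico a b :=
    Set.Ico_union_Ico_eq_Ico (left_lt_add_div_two.2 hab).le (add_div_two_lt_right.2 hab).le
  have hmass := normalizedMass_glueSeq_nil_eq_ofReal hab hs hA₁ hA₂ hmα hmβ
  have hfi : IntegrableOn f (Set.Ico a b) := hunion ▸ hfi₁.union hfi₂
  refine ⟨fun x hx => ?_, hfi, ?_, ?_, ?_, hmass⟩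
  · exact (hunion.symm ▸ hx).elim (hf₁ x) (hf₂ x)
  · rw [average_Ico_eq_add_div_two hab hfi, hft₁, hft₂]
  · rintro (_ | ⟨_ | _, J⟩)
    exacts [hs, hα J, hβ J]
  · exact carlesonConstant_glueSeq_le_one_iff.2
      ⟨hmass.trans_le (ENNReal.ofReal_le_one.2 hA), hCα, hCβ⟩

theorem admissible_const_zero (hab : a < b) (ht : 0 ≤ t) :
    Admissible a b t 0 (fun _ => t) 0 := by
  have hm (J : List Bool) : normalizedMass a b 0 J = 0 := by simp [normalizedMass]
  exact ⟨fun _ _ => ht, integrableOn_const measure_Ico_lt_top.ne,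
    setAverage_const (by simpa using hab) measure_Ico_lt_top.ne t, fun _ => le_rfl,
    iSup_le fun J => (hm J).trans_le zero_le_one, by rw [hm, ENNReal.ofReal_zero]⟩

theorem admissible_const (hab : a < b) (ht : 0 ≤ t) (hA : 0 ≤ A) (hA1 : A ≤ 1) :
    Admissible a b t A (fun _ => t) (glueSeq A 0 0) := by
  simpa using Admissible.glue hab hA le_rfl le_rfl (by simpa using hA1)
    (admissible_const_zero (left_lt_add_div_two.2 hab) ht)
    (admissible_const_zero (add_div_two_lt_right.2 hab) ht)

end Admissible

section UpperBound

/-- The sequence `α` cut off to the first `n` dyadic generations. -/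
def truncate (n : ℕ) (α : List Bool → ℝ) (J : List Bool) : ℝ := if J.length < n then α J else 0

theorem truncate_glueSeq (n : ℕ) (s : ℝ) (α β : List Bool → ℝ) :
    truncate (n + 1) (glueSeq s α β) = glueSeq s (truncate n α) (truncate n β) := by
  ext (_ | ⟨_ | _, J⟩) <;> simp [truncate, glueSeq]

variable {a b lam : ℝ} {α : List Bool → ℝ} {f : ℝ → ℝ} {x : ℝ}

theorem monotone_lernerOp_truncate :
    Monotone fun n => lernerOp a b (truncate n α) f x := by
  intro m n hmn
  refine ENNReal.tsum_le_tsum fun J => Set.indicator_le_indicator ?_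
  by_cases hJ : J.length < m
  · rw [truncate, truncate, if_pos hJ, if_pos (hJ.trans_le hmn)]
  · simp [truncate, hJ]

theorem exists_lt_lernerOp_truncate {y : ℝ≥0∞} (h : y < lernerOp a b α f x) :
    ∃ n, y < lernerOp a b (truncate n α) f x := by
  rw [lernerOp, ENNReal.tsum_eq_iSup_sum, lt_iSup_iff] at h
  obtain ⟨S, hS⟩ := h
  refine ⟨S.sup List.length + 1, hS.trans_le ((Finset.sum_le_sum fun J hJ => ?_).trans
    (ENNReal.sum_le_tsum S))⟩
  rw [truncate, if_pos (Nat.lt_succ_of_le (Finset.le_sup hJ))]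

theorem levelDensity_le_of_forall_truncate {r : ℝ} (hab : a < b)
    (h : ∀ n, levelDensity a b (truncate n α) f lam ≤ r) : levelDensity a b α f lam ≤ r := by
  have hmono : Monotone fun n => levelSet a b (truncate n α) f lam := fun m n hmn x hx =>
    ⟨hx.1, hx.2.trans_le (monotone_lernerOp_truncate hmn)⟩
  have hsub : levelSet a b α f lam ⊆ ⋃ n, levelSet a b (truncate n α) f lam := fun x hx =>
    let ⟨n, hn⟩ := exists_lt_lernerOp_truncate hx.2
    Set.mem_iUnion.2 ⟨n, hx.1, hn⟩
  have hr : 0 ≤ r * (b - a) :=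
    mul_nonneg ((levelDensity_nonneg hab.le).trans (h 0)) (sub_nonneg.2 hab.le)
  refine (div_le_iff₀ (sub_pos.2 hab)).2 (ENNReal.toReal_le_of_le_ofReal hr ?_)
  refine (measure_mono hsub).trans (hmono.measure_iUnion.trans_le (iSup_le fun n => ?_))
  rw [ENNReal.le_ofReal_iff_toReal_le volume_levelSet_ne_top hr]
  exact (div_le_iff₀ (sub_pos.2 hab)).1 (h n)

variable {B : ℝ → ℝ → ℝ → ℝ} {t A : ℝ}

theorem IsSupersolution.levelDensity_truncate_le (hB : IsSupersolution B) (n : ℕ) (hab : a < b)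
    (hA : 0 ≤ A) (hlam : 0 < lam) (h : Admissible a b t A f α) :
    levelDensity a b (truncate n α) f lam ≤ B t A lam := by
  induction n generalizing a b t A lam α with
  | zero =>
    simpa [levelDensity, levelSet, lernerOp, truncate] using hB.nonneg h.average_nonneg hA hlam
  | succ n ih =>
    obtain ⟨s, α, β, rfl⟩ := exists_eq_glueSeq α
    obtain ⟨hs, t₁, A₁, t₂, A₂, hA₁, hA₂, h₁, h₂, ht, hmass⟩ := h.exists_halves hab hA
    have ht0 := h.average_nonneg
    rcases le_or_gt lam (s * t) with hst | hst
    · have hsA : s ≤ A := by linarith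
      exact (levelDensity_le_one hab.le).trans
        (hB.one_le hA h.mass_le_one hlam (hst.trans (by gcongr)))
    have hlam' := sub_pos.2 hst
    have hsplit := levelDensity_glueSeq (α := truncate n α) (β := truncate n β) hab hs
      (h.2.2.1.symm ▸ ht0) hlam'.le
    rw [h.2.2.1, sub_add_cancel] at hsplit
    calc levelDensity a b (truncate (n + 1) (glueSeq s α β)) f lam
        ≤ (B t₁ A₁ (lam - s * t) + B t₂ A₂ (lam - s * t)) / 2 := by
          rw [truncate_glueSeq, hsplit]
          gcongr
          · exact ih (left_lt_add_div_two.2 hab) hA₁ hlam' h₁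
          · exact ih (add_div_two_lt_right.2 hab) hA₂ hlam' h₂
      _ ≤ B t ((A₁ + A₂) / 2) (lam - s * t) :=
          (hB.midpoint_le h₁.average_nonneg h₂.average_nonneg hA₁ hA₂ hlam').trans_eq (by rw [← ht])
      _ ≤ B t ((A₁ + A₂) / 2 + s) (lam - s * t + s * t) :=
          hB.jump_le ht0 (by positivity) hs (by linarith [h.mass_le_one]) hlam'
      _ = B t A lam := by rw [sub_add_cancel, add_comm _ s, ← hmass]

theorem IsSupersolution.levelDensity_le (hB : IsSupersolution B) (hab : a < b) (hA : 0 ≤ A)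
    (hlam : 0 < lam) (h : Admissible a b t A f α) : levelDensity a b α f lam ≤ B t A lam :=
  levelDensity_le_of_forall_truncate hab fun n => hB.levelDensity_truncate_le n hab hA hlam h

end UpperBound

section LowerBound

/-- On every interval, admissible pairs with average `t` and mass `A` have level densities at the
level `lam` that come arbitrarily close to `r`, or exceed it. -/
def Approached (t A lam r : ℝ) : Prop :=
  ∀ s < r, ∀ a b : ℝ, a < b →
    ∃ f α, Admissible a b t A f α ∧ s ≤ levelDensity a b α f lam

variable {t A lam r : ℝ}

theorem Approached.mono {r' : ℝ} (h : Approached t A lam r) (hr : r' ≤ r) :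
    Approached t A lam r' :=
  fun s hs => h s (hs.trans_le hr)

theorem approached_of_forall_lt (h : ∀ r' < r, Approached t A lam r') : Approached t A lam r :=
  fun s hs =>
    let ⟨r', hs', hr'⟩ := exists_between hs
    h r' hr' s hs'

theorem approached_zero (ht : 0 ≤ t) (hA : 0 ≤ A) (hA1 : A ≤ 1) : Approached t A lam 0 :=
  fun _ hs _ _ hab =>
    ⟨_, _, admissible_const hab ht hA hA1, hs.le.trans (levelDensity_nonneg hab.le)⟩

theorem approached_one (ht : 0 ≤ t) (hA : 0 ≤ A) (hA1 : A ≤ 1) (hlam : 0 ≤ lam)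
    (h : lam < A * t) : Approached t A lam 1 := by
  intro s hs a b hab
  have hadm := admissible_const hab ht hA hA1
  refine ⟨_, _, hadm, hs.le.trans_eq ?_⟩
  have hlevel : levelSet a b (glueSeq A 0 0) (fun _ => t) lam = Set.Ico a b := by
    refine levelSet_subset.antisymm fun x hx => ⟨hx, ?_⟩
    rw [lernerOp_glueSeq hx, hadm.2.2.1]
    exact ((ENNReal.ofReal_lt_ofReal_iff_of_nonneg hlam).2 h).trans_le le_self_add
  rw [levelDensity, hlevel, Real.volume_real_Ico_of_le hab.le, div_self (sub_pos.2 hab).ne']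

theorem Approached.midpoint {t₁ t₂ A₁ A₂ r₁ r₂ : ℝ} (hA₁ : 0 ≤ A₁) (hA₂ : 0 ≤ A₂)
    (h₁ : Approached t₁ A₁ lam r₁) (h₂ : Approached t₂ A₂ lam r₂) :
    Approached ((t₁ + t₂) / 2) ((A₁ + A₂) / 2) lam ((r₁ + r₂) / 2) := by
  classical
  intro s hs a b hab
  have hl := left_lt_add_div_two.2 hab
  have hr := add_div_two_lt_right.2 hab
  obtain ⟨f₁, α₁, hf₁, hs₁⟩ := h₁ (s + (r₁ - r₂) / 2) (by linarith) _ _ hl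
  obtain ⟨f₂, α₂, hf₂, hs₂⟩ := h₂ (s + (r₂ - r₁) / 2) (by linarith) _ _ hr
  set f := (Set.Iio ((a + b) / 2)).piecewise f₁ f₂
  have hfl : Set.EqOn f₁ f (Set.Ico a ((a + b) / 2)) := fun x hx =>
    ((Set.Iio _).piecewise_eq_of_mem f₁ f₂ hx.2).symm
  have hfr : Set.EqOn f₂ f (Set.Ico ((a + b) / 2) b) := fun x hx =>
    ((Set.Iio _).piecewise_eq_of_notMem f₁ f₂ hx.1.not_gt).symm
  refine ⟨f, glueSeq 0 α₁ α₂, ?_, ?_⟩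
  · simpa only [zero_add] using Admissible.glue hab le_rfl hA₁ hA₂
      (by linarith [hf₁.mass_le_one, hf₂.mass_le_one]) (hf₁.congr hfl) (hf₂.congr hfr)
  · rw [levelDensity_glueSeq_zero hab, ← levelDensity_congr hl hfl, ← levelDensity_congr hr hfr]
    linarith

theorem Approached.jump {c : ℝ} (hA : 0 ≤ A) (hc : 0 ≤ c) (hAc : A + c ≤ 1) (hlam : 0 ≤ lam)
    (h : Approached t A lam r) : Approached t (A + c) (lam + c * t) r := by
  intro s hs a b hab
  obtain ⟨f, α, hadm, hdens⟩ := h s hs a b hab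
  obtain ⟨s₀, α, β, rfl⟩ := exists_eq_glueSeq α
  obtain ⟨hs₀, t₁, A₁, t₂, A₂, hA₁, hA₂, h₁, h₂, ht, rfl⟩ := hadm.exists_halves hab hA
  have hjump := levelDensity_glueSeq_add (α := α) (β := β) hs₀ hc
    (hadm.2.2.1.symm ▸ hadm.average_nonneg) hlam
  rw [hadm.2.2.1] at hjump
  refine ⟨f, glueSeq (s₀ + c) α β, ?_, hdens.trans_eq hjump.symm⟩
  rw [add_right_comm] at hAc ⊢
  rw [ht]
  exact Admissible.glue hab (by positivity) hA₁ hA₂ hAc h₁ h₂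

theorem Approached.scale_sub_pow (ht : 0 ≤ t) (hA : 0 ≤ A) (hA1 : A ≤ 1) (hr : 0 ≤ r)
    (h : Approached t A lam r) (n : ℕ) {θ : ℝ} (hθ : θ ∈ Set.Icc 0 1) :
    Approached (θ * t) (θ * A) lam ((θ - (1 / 2) ^ n) * r) := by
  obtain ⟨hθ0, hθ1⟩ := hθ
  -- Each average, with zero data or with `h` itself, realizes one binary digit of `θ`.
  induction n generalizing θ with
  | zero =>
    exact (approached_zero (by positivity) (by positivity) (mul_le_one₀ hθ1 hA hA1)).mono
      (mul_nonpos_of_nonpos_of_nonneg (by simpa using hθ1) hr)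
  | succ n ih =>
    rcases le_total θ (1 / 2) with hθ | hθ
    · convert (ih (θ := 2 * θ) (by linarith) (by linarith)).midpoint (by positivity) le_rfl
        (approached_zero le_rfl le_rfl zero_le_one) using 1 <;> ring
    · convert (ih (θ := 2 * θ - 1) (by linarith) (by linarith)).midpoint
        (mul_nonneg (by linarith) hA) hA h using 1 <;> ring

theorem Approached.scale (ht : 0 ≤ t) (hA : 0 ≤ A) (hA1 : A ≤ 1) (hr : 0 ≤ r)
    (h : Approached t A lam r) {θ : ℝ} (hθ : θ ∈ Set.Icc 0 1) :
    Approached (θ * t) (θ * A) lam (θ * r) := by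
  refine approached_of_forall_lt fun s hs => ?_
  have hlim : Filter.Tendsto (fun n : ℕ => (θ - (1 / 2) ^ n) * r) Filter.atTop (nhds (θ * r)) := by
    simpa using ((tendsto_pow_atTop_nhds_zero_of_lt_one one_half_pos.le
      one_half_lt_one).const_sub θ).mul_const r
  obtain ⟨n, hn⟩ := (hlim.eventually_const_lt hs).exists
  exact (h.scale_sub_pow ht hA hA1 hr n hθ).mono hn.le

theorem Approached.concentrate {q : ℝ} (hq : 0 < q) (hq1 : q ≤ 1) (ht : 0 ≤ t) (hr : 0 ≤ r)
    (hlam : 0 ≤ lam - (1 - q) * t) (h : Approached (t / q) 1 (lam - (1 - q) * t) r) :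
    Approached t 1 lam (q * r) := by
  have hscale := h.scale (by positivity) zero_le_one le_rfl hr ⟨hq.le, hq1⟩
  rw [mul_div_cancel₀ _ hq.ne', mul_one] at hscale
  simpa using hscale.jump hq.le (sub_nonneg.2 hq1) (by simp) hlam

-- `lam + q * t` is invariant under the step `(t, lam) ↦ (t / q, lam - (1 - q) * t)` of
-- `Approached.concentrate`; after `n` steps the average is `t / q ^ n` and exceeds the level.
theorem approached_pow {q : ℝ} (hq : 0 < q) (hq1 : q ≤ 1) (n : ℕ) {t lam : ℝ} (ht : 0 < t)
    (hlam : 0 ≤ lam) (h : lam + q * t < (1 + q) * t / q ^ n) : Approached t 1 lam (q ^ n) := by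
  induction n generalizing t lam with
  | zero =>
    rw [pow_zero, div_one] at h
    simpa using approached_one ht.le zero_le_one le_rfl hlam (by linarith)
  | succ n ih =>
    rcases lt_or_ge lam t with hlt | hle
    · exact (approached_one ht.le zero_le_one le_rfl hlam (by linarith)).mono
        (pow_le_one₀ hq.le hq1)
    have hlam' : 0 ≤ lam - (1 - q) * t := by nlinarith
    rw [pow_succ']
    refine (ih (by positivity) hlam' ?_).concentrate hq hq1 ht.le (by positivity) hlam'
    calc lam - (1 - q) * t + q * (t / q) = lam + q * t := by field_simp; ring
      _ < (1 + q) * t / q ^ (n + 1) := h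
      _ = (1 + q) * (t / q) / q ^ n := by rw [pow_succ']; field_simp

theorem approached_full_mass {t lam : ℝ} (ht : 0 < t) (h : t ≤ lam) :
    Approached t 1 lam (2 * t / (lam + t)) := by
  have hlam := ht.trans_le h
  refine approached_of_forall_lt fun r hr => ?_
  rcases le_or_gt r 0 with hr0 | hr0
  · exact (approached_zero ht.le zero_le_one le_rfl).mono hr0
  have hr1 : r ≤ 1 := hr.le.trans ((div_le_one (by positivity)).2 (by linarith))
  have hq : Filter.Tendsto (fun n : ℕ => r ^ ((n : ℝ)⁻¹)) Filter.atTop (nhds 1) := by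
    simpa using tendsto_const_nhds.rpow (tendsto_inv_atTop_nhds_zero_nat (𝕜 := ℝ)) (.inl hr0.ne')
  have hlim : lam + 1 * t < (1 + 1) * t / r := by
    rw [lt_div_iff₀ (by positivity)] at hr ⊢
    linarith
  obtain ⟨n, hn, hn0⟩ := (((hq.mul_const t).const_add lam).eventually_lt
    (((hq.const_add 1).mul_const t).div_const r) hlim |>.and (Filter.eventually_ne_atTop 0)).exists
  have hpow : (r ^ ((n : ℝ)⁻¹)) ^ n = r := Real.rpow_inv_natCast_pow hr0.le hn0
  rw [← hpow]
  exact approached_pow (by positivity) (Real.rpow_le_one hr0.le hr1 (by positivity)) n ht hlam.le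
    (by rwa [hpow])

theorem approached_of_le (ht : 0 < t) (hA : 0 < A) (hA1 : A ≤ 1) (h : t ≤ A * lam) :
    Approached t A lam (2 * A * t / (A * lam + t)) := by
  have hlam : 0 < lam := pos_of_mul_pos_right (ht.trans_le h) hA.le
  have hscale := (approached_full_mass (div_pos ht hA) ((div_le_iff₀' hA).2 h)).scale
    (by positivity) zero_le_one le_rfl (by positivity) ⟨hA.le, hA1⟩
  rw [mul_div_cancel₀ _ hA.ne', mul_one] at hscale
  convert hscale using 1
  field_simp

theorem approached_sqrt (ht : 0 < t) (hA : 0 < A) (hlam : 0 < lam) (h : A * lam < t)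
    (h' : A * t ≤ lam) : Approached t A lam √(A * t / lam) := by
  refine approached_of_forall_lt fun s hs => ?_
  have hA_lt : A < √(A * t / lam) := Real.lt_sqrt_of_sq_lt <| by
    rw [lt_div_iff₀ hlam, sq, mul_assoc]
    gcongr
  have hsqrt : √(A * t / lam) ≤ 1 := Real.sqrt_le_one.2 ((div_le_one hlam).2 h')
  obtain ⟨θ, hθ, hθ_lt⟩ := exists_between (max_lt hs hA_lt)
  obtain ⟨hsθ, hAθ⟩ := max_lt_iff.1 hθ
  have hθ0 : 0 < θ := hA.trans hAθ
  have hlevel : lam < A / θ * (t / θ) := by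
    have hsq := (Real.lt_sqrt hθ0.le).1 hθ_lt
    rw [lt_div_iff₀ hlam] at hsq
    rw [div_mul_div_comm, lt_div_iff₀ (by positivity)]
    linarith
  have hAθ1 : A / θ ≤ 1 := (div_le_one hθ0).2 hAθ.le
  have hscale := (approached_one (by positivity) (by positivity) hAθ1 hlam.le hlevel).scale
    (by positivity) (by positivity) hAθ1 zero_le_one ⟨hθ0.le, hθ_lt.le.trans hsqrt⟩
  rw [mul_div_cancel₀ _ hθ0.ne', mul_div_cancel₀ _ hθ0.ne', mul_one] at hscale
  exact hscale.mono hsθ.le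

theorem approached_bellman (ht : 0 < t) (hA : 0 < A) (hA1 : A ≤ 1) (hlam : 0 < lam) :
    Approached t A lam (bellman t A lam) := by
  rcases le_or_gt t (A * lam) with h | h
  · rw [bellman, mixedMean_div_of_le hlam h]
    exact (approached_of_le ht hA hA1 h).mono (min_le_right _ _)
  rcases lt_or_ge lam (A * t) with hlt | hle
  · exact (approached_one ht.le hA.le hA1 hlam.le hlt).mono (min_le_left _ _)
  · rw [bellman, mixedMean_div_of_ge hA.le hlam h.le]
    exact (approached_sqrt ht hA hlam h hle).mono (min_le_right _ _)

end LowerBound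

end LernerOperator

theorem theorem1 (a b : ℝ) (hab : a < b) (t A lam : ℝ) (ht : 0 < t) (hA : 0 < A) (hA1 : A ≤ 1)
    (hlam : 0 < lam) :
    IsLUB
      {r : ℝ | ∃ (f : ℝ → ℝ) (α : List Bool → ℝ), LernerOperator.Admissible a b t A f α ∧
        r = (MeasureTheory.volume {x : ℝ | x ∈ Set.Ico a b ∧
          ENNReal.ofReal lam < LernerOperator.lernerOp a b α f x}).toReal / (b - a)}
      (if t ≤ A * lam ∧ A * lam ≤ lam then 2 * A * t / (A * lam + t)
        else if A ≤ min (t / lam) (lam / t) then Real.sqrt (A * t / lam)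
        else 1) := by
  rw [← LernerOperator.bellman_eq ht hA hA1 hlam]
  constructor
  · rintro _ ⟨f, α, h, rfl⟩
    exact LernerOperator.isSupersolution_bellman.levelDensity_le hab hA.le hlam h
  · refine fun u hu => le_of_forall_lt_imp_le_of_dense fun s hs => ?_
    obtain ⟨f, α, h, hsα⟩ := LernerOperator.approached_bellman ht hA hA1 hlam s hs a b hab
    exact hsα.trans (hu ⟨f, α, h, rfl⟩)
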